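/- **Setting.** A numerical semigroup is a submonoid $\Lambda$ of $(\mathbb N,+)$, $\mathbb N=\{0,1,2,\dots\}$, with finite complement; its embedding dimension is the number of elements of its minimal system of generators. An ideal of $\Lambda$ is a subset $I\subseteq\Lambda$ with $I+\Lambda\subseteq I$; it is irreducible if it cannot be written as the intersection of two proper ideals (ideals different from $\Lambda$), each containing it properly. The graph $G_I(\Lambda)$ is the simple graph whose vertices are the nonzero elements of $\Lambda\setminus I$, where two distinct vertices $y,z$ are adjacent if and only if $y+z\in I$. Its order $|G_I(\Lambda)|$ is its number of vertices. A graph is planar if it can be drawn in the plane, with vertices as distinct points and edges as simple arcs joining their ends, so that no edge passes through a vertex other than its ends and two edges meet only at a vertex to which both are incident. A graph of order 6 is *of type $k$* ($1\le k\le 4$) if it is isomorphic to the graph on $\{0,\dots,5\}$ with the following edges (and degree sequence); $ij$ denotes the edge $\{i,j\}$: * type 1, $(1,2,3,3,4,5)$: $01,12,13,14,15,23,25,35,45$; * type 2, $(2,3,3,4,5,5)$: $01,04,12,13,14,15,24,25,34,35,45$; * type 3, $(2,3,4,4,4,5)$: $01,04,12,13,14,15,23,24,25,34,35$; * type 4,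 $(3,3,4,4,5,5)$: $01,02,03,04,05,12,13,14,15,25,34,35$. A graph of order 7 is *of type $k$* ($1\le k\le 3$) if it is isomorphic to the graph on $\{0,\dots,6\}$ with the following edges (and degree sequence): * type 1, $(1,2,3,3,4,5,6)$: $01,02,03,04,05,06,13,14,15,16,36,46$; * type 2, $(2,3,3,4,5,5,6)$: $01,02,04,05,06,12,15,16,23,24,25,26,35,45$; * type 3, $(3,3,3,5,5,5,6)$: $01,02,04,05,06,12,13,15,16,23,24,25,26,36,46$. **Theorem.** Let $\Lambda$ be a numerical semigroup of embedding dimension $n\ge 2$ and let $I$ be an irreducible ideal of $\Lambda$. Then $G_I(\Lambda)$ is planar if one of the following holds: 1. $|G_I(\Lambda)|\le 5$; 2. $|G_I(\Lambda)|=6$ and $G_I(\Lambda)$ is of type 1, 2, 3 or 4; 3. $|G_I(\Lambda)|=7$ and $G_I(\Lambda)$ is of type 1, 2 or 3. -/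

import Mathlib

namespace NumSemigroup

/-- A numerical semigroup: a submonoid of `ℕ` with finite complement. -/
def IsNumericalSemigroup (Λ : AddSubmonoid ℕ) : Prop :=
  ((Λ : Set ℕ)ᶜ).Finite

/-- The embedding dimension: the number of elements of the minimal system of generators, that is,
the least number of elements of a generating set. -/
noncomputable def embeddingDimension (Λ : AddSubmonoid ℕ) : ℕ :=
  sInf {n : ℕ | ∃ A : Finset ℕ, AddSubmonoid.closure (A : Set ℕ) = Λ ∧ A.card = n}

/-- An (integral) ideal of `Λ`: a subset `I` of `Λ` with `I + Λ ⊆ I`. -/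
def IsIdeal (Λ : AddSubmonoid ℕ) (I : Set ℕ) : Prop :=
  I ⊆ (Λ : Set ℕ) ∧ ∀ i ∈ I, ∀ s ∈ Λ, i + s ∈ I

/-- An irreducible ideal: an ideal that is not the intersection of two proper ideals each of which
contains it properly. -/
def IsIrreducibleIdeal (Λ : AddSubmonoid ℕ) (I : Set ℕ) : Prop :=
  IsIdeal Λ I ∧
    ¬ ∃ J K : Set ℕ, IsIdeal Λ J ∧ IsIdeal Λ K ∧ J ≠ (Λ : Set ℕ) ∧ K ≠ (Λ : Set ℕ) ∧
      I ⊂ J ∧ I ⊂ K ∧ I = J ∩ K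

/-- The vertices of the graph of an ideal: the nonzero elements of `Λ \ I`. -/
abbrev Vertex (Λ : AddSubmonoid ℕ) (I : Set ℕ) : Type :=
  {y : ℕ // y ∈ (Λ : Set ℕ) \ I ∧ y ≠ 0}

/-- The graph `G_I(Λ)`: distinct vertices `y`, `z` are adjacent if and only if `y + z ∈ I`. -/
def idealGraph (Λ : AddSubmonoid ℕ) (I : Set ℕ) : SimpleGraph (Vertex Λ I) where
  Adj y z := y ≠ z ∧ (y : ℕ) + (z : ℕ) ∈ I
  symm := ⟨fun _ _ h => ⟨h.1.symm, by rw [add_comm]; exact h.2⟩⟩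
  loopless := ⟨fun _ h => h.1 rfl⟩

/-- A graph is planar if it can be drawn in the plane without crossings: vertices are distinct
points, each edge is a simple arc joining its two ends, an edge passes through no vertex other than
its ends, and two different edges meet only at a vertex to which both are incident. -/
def IsPlanar {V : Type*} (G : SimpleGraph V) : Prop :=
  ∃ (pos : V → EuclideanSpace ℝ (Fin 2))
    (arc : G.edgeSet → unitInterval → EuclideanSpace ℝ (Fin 2)),
    Function.Injective pos ∧
    (∀ e : G.edgeSet, Continuous (arc e) ∧ Function.Injective (arc e)) ∧
    (∀ e : G.edgeSet, Sym2.map pos (e : Sym2 V) = s(arc e 0, arc e 1)) ∧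
    (∀ (e : G.edgeSet) (v : V), pos v ∈ Set.range (arc e) → v ∈ (e : Sym2 V)) ∧
    (∀ e f : G.edgeSet, e ≠ f → ∀ p ∈ Set.range (arc e) ∩ Set.range (arc f),
      ∃ v : V, v ∈ (e : Sym2 V) ∧ v ∈ (f : Sym2 V) ∧ pos v = p)

/-- Order 6, type 1; degree sequence (1, 2, 3, 3, 4, 5). -/
def sixType1 : SimpleGraph (Fin 6) :=
  SimpleGraph.fromEdgeSet
    {s(0, 1), s(1, 2), s(1, 3), s(1, 4), s(1, 5), s(2, 3), s(2, 5), s(3, 5), s(4, 5)}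

/-- Order 6, type 2; degree sequence (2, 3, 3, 4, 5, 5). -/
def sixType2 : SimpleGraph (Fin 6) :=
  SimpleGraph.fromEdgeSet
    {s(0, 1), s(0, 4), s(1, 2), s(1, 3), s(1, 4), s(1, 5), s(2, 4), s(2, 5), s(3, 4), s(3, 5),
      s(4, 5)}

/-- Order 6, type 3; degree sequence (2, 3, 4, 4, 4, 5). -/
def sixType3 : SimpleGraph (Fin 6) :=
  SimpleGraph.fromEdgeSet
    {s(0, 1), s(0, 4), s(1, 2), s(1, 3), s(1, 4), s(1, 5), s(2, 3), s(2, 4), s(2, 5), s(3, 4),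
      s(3, 5)}

/-- Order 6, type 4; degree sequence (3, 3, 4, 4, 5, 5). -/
def sixType4 : SimpleGraph (Fin 6) :=
  SimpleGraph.fromEdgeSet
    {s(0, 1), s(0, 2), s(0, 3), s(0, 4), s(0, 5), s(1, 2), s(1, 3), s(1, 4), s(1, 5), s(2, 5),
      s(3, 4), s(3, 5)}

/-- Order 7, type 1; degree sequence (1, 2, 3, 3, 4, 5, 6). -/
def sevenType1 : SimpleGraph (Fin 7) :=
  SimpleGraph.fromEdgeSet
    {s(0, 1), s(0, 2), s(0, 3), s(0, 4), s(0, 5), s(0, 6), s(1, 3), s(1, 4), s(1, 5), s(1, 6),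
      s(3, 6), s(4, 6)}

/-- Order 7, type 2; degree sequence (2, 3, 3, 4, 5, 5, 6). -/
def sevenType2 : SimpleGraph (Fin 7) :=
  SimpleGraph.fromEdgeSet
    {s(0, 1), s(0, 2), s(0, 4), s(0, 5), s(0, 6), s(1, 2), s(1, 5), s(1, 6), s(2, 3), s(2, 4),
      s(2, 5), s(2, 6), s(3, 5), s(4, 5)}

/-- Order 7, type 3; degree sequence (3, 3, 3, 5, 5, 5, 6). -/
def sevenType3 : SimpleGraph (Fin 7) :=
  SimpleGraph.fromEdgeSet
    {s(0, 1), s(0, 2), s(0, 4), s(0, 5), s(0, 6), s(1, 2), s(1, 3), s(1, 5), s(1, 6), s(2, 3),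
      s(2, 4), s(2, 5), s(2, 6), s(3, 6), s(4, 6)}

/-- `G` is isomorphic to `H`. -/
def IsOfType {V W : Type*} (G : SimpleGraph V) (H : SimpleGraph W) : Prop :=
  Nonempty (G ≃g H)

end NumSemigroup

namespace NumSemigroup

/-! The seven listed types are finite graphs, each planar by an explicit straight-line drawing with
integer vertices. In general position, two segments without a common end are disjoint exactly when
the line through one leaves the other strictly on one side, so correctness reduces to signs of
integer determinants (`isPlanar_of_list`).

For order at most 5 the only obstruction is K₅, since K₅ minus an edge is drawn the same way.
Irreducibility excludes it. A vertex `y` with `y + z ∈ I` for all vertices `z` makes `I ∪ {y}` an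
ideal, and two such vertices would split `I` as an intersection. So the largest vertex `m` is the
only one. In a complete graph this forces `2y = m` for every other vertex `y`, so there are at most
two vertices. -/

/-- Planarity passes to subgraphs. -/
theorem IsPlanar.of_injective_hom {V W : Type*} {G : SimpleGraph V} {H : SimpleGraph W}
    (hH : IsPlanar H) (f : G →g H) (hf : Function.Injective f) : IsPlanar G := by
  obtain ⟨pos, arc, hpos, harc, hends, hvert, hcross⟩ := hH
  have hmem : ∀ (e : G.edgeSet) (w : W), w ∈ ((f.mapEdgeSet e : H.edgeSet) : Sym2 W) →
      ∃ v, v ∈ (e : Sym2 V) ∧ f v = w := by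
    intro e w hw
    exact Sym2.mem_map.1 hw
  refine ⟨pos ∘ f, fun e => arc (f.mapEdgeSet e), hpos.comp hf, fun e => harc _, ?_, ?_, ?_⟩
  · intro e
    rw [← hends, ← Sym2.map_map]
    rfl
  · intro e v hv
    obtain ⟨u, hu, huv⟩ := hmem e (f v) (hvert _ _ hv)
    rwa [← hf huv]
  · intro e g heg p hp
    obtain ⟨w, hwe, hwg, hw⟩ :=
      hcross _ _ (fun h => heg (SimpleGraph.Hom.mapEdgeSet.injective f hf h)) p hp
    obtain ⟨u, hu, rfl⟩ := hmem e w hwe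
    obtain ⟨v, hv, huv⟩ := hmem g _ hwg
    rw [hf huv] at hv
    exact ⟨u, hu, hv, hw⟩

/-! ### Straight-line drawings -/

/-- Twice the signed area of the triangle `a b c`. -/
def orient {R : Type*} [CommRing R] (a b c : R × R) : R :=
  (b.1 - a.1) * (c.2 - a.2) - (b.2 - a.2) * (c.1 - a.1)

theorem orient_segment {a b : ℝ × ℝ} (t : ℝ) :
    orient a b (a.1 + t * (b.1 - a.1), a.2 + t * (b.2 - a.2)) = 0 := by
  simp only [orient]; ring

/-- The segments `ab` and `cd` are disjoint if `c` and `d` lie strictly on one side of `ab`. -/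
theorem segment_ne_of_orient_mul_pos {a b c d : ℝ × ℝ} (h : 0 < orient a b c * orient a b d)
    {s t : ℝ} (ht : t ∈ Set.Icc (0 : ℝ) 1)
    (h1 : a.1 + s * (b.1 - a.1) = c.1 + t * (d.1 - c.1))
    (h2 : a.2 + s * (b.2 - a.2) = c.2 + t * (d.2 - c.2)) : False := by
  -- `orient a b` is affine in its third argument and vanishes at the common point, which lies on
  -- the line `ab`.
  have key : (1 - t) * orient a b c + t * orient a b d = 0 := by
    simp only [orient]
    linear_combination (b.2 - a.2) * h1 - (b.1 - a.1) * h2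
  obtain ⟨ht0, ht1⟩ := ht
  have hsq : 0 < orient a b c ^ 2 := by
    have : orient a b c ≠ 0 := by rintro h0; simp [h0] at h
    positivity
  have : (1 - t) * orient a b c ^ 2 + t * (orient a b c * orient a b d) = 0 := by
    linear_combination orient a b c * key
  rcases ht0.eq_or_lt with rfl | ht0
  · linarith
  · nlinarith [mul_pos ht0 h, mul_nonneg (sub_nonneg.2 ht1) hsq.le]

/-- Two non-collinear segments from `a` meet only at `a`. -/
theorem segment_param_eq_zero {a b d : ℝ × ℝ} (h : orient a b d ≠ 0) {s t : ℝ}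
    (h1 : a.1 + s * (b.1 - a.1) = a.1 + t * (d.1 - a.1))
    (h2 : a.2 + s * (b.2 - a.2) = a.2 + t * (d.2 - a.2)) : s = 0 := by
  have : s * orient a b d = 0 := by
    simp only [orient]
    linear_combination (d.2 - a.2) * h1 - (d.1 - a.1) * h2
  exact (mul_eq_zero.1 this).resolve_right h

/-- A straight-line drawing in general position with integer coordinates, in which any two edges
without a common end are separated by the line through one of them, shows that a graph is planar. -/
theorem isPlanar_of_points {V : Type*} (H : SimpleGraph V) (p : V → ℤ × ℤ)
    (hinj : Function.Injective p)
    (hgen : ∀ a b c, a ≠ b → a ≠ c → b ≠ c → orient (p a) (p b) (p c) ≠ 0)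
    (hsep : ∀ a b c d, H.Adj a b → H.Adj c d → a ≠ c → a ≠ d → b ≠ c → b ≠ d →
      0 < orient (p a) (p b) (p c) * orient (p a) (p b) (p d) ∨
      0 < orient (p c) (p d) (p a) * orient (p c) (p d) (p b)) : IsPlanar H := by
  set q : V → ℝ × ℝ := fun v => ((p v).1, (p v).2) with hq
  have hoq : ∀ a b c, orient (q a) (q b) (q c) = (orient (p a) (p b) (p c) : ℤ) := by
    intro a b c; simp [orient, hq]
  have hqinj : Function.Injective q := by
    intro a b hab
    simp only [hq, Prod.mk.injEq, Int.cast_inj] at hab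
    exact hinj (Prod.ext hab.1 hab.2)
  have hgen' : ∀ a b c, a ≠ b → a ≠ c → b ≠ c → orient (q a) (q b) (q c) ≠ 0 := by
    intro a b c h1 h2 h3
    rw [hoq]; exact_mod_cast hgen a b c h1 h2 h3
  have hsep' : ∀ a b c d, H.Adj a b → H.Adj c d → a ≠ c → a ≠ d → b ≠ c → b ≠ d →
      0 < orient (q a) (q b) (q c) * orient (q a) (q b) (q d) ∨
      0 < orient (q c) (q d) (q a) * orient (q c) (q d) (q b) := by
    intro a b c d h1 h2 h3 h4 h5 h6
    simp only [hoq]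
    exact_mod_cast hsep a b c d h1 h2 h3 h4 h5 h6
  let seg : V → V → unitInterval → EuclideanSpace ℝ (Fin 2) := fun a b t =>
    !₂[(q a).1 + t * ((q b).1 - (q a).1), (q a).2 + t * ((q b).2 - (q a).2)]
  have hseg_eq : ∀ {a b c d s t}, seg a b s = seg c d t →
      (q a).1 + s * ((q b).1 - (q a).1) = (q c).1 + t * ((q d).1 - (q c).1) ∧
      (q a).2 + s * ((q b).2 - (q a).2) = (q c).2 + t * ((q d).2 - (q c).2) := by
    intro a b c d s t h
    have h0 := congrArg (fun v : EuclideanSpace ℝ (Fin 2) => v 0) h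
    have h1 := congrArg (fun v : EuclideanSpace ℝ (Fin 2) => v 1) h
    simpa [seg] using And.intro h0 h1
  let pos : V → EuclideanSpace ℝ (Fin 2) := fun v => !₂[(q v).1, (q v).2]
  have hseg0 : ∀ a b, seg a b 0 = pos a := by intro a b; simp [seg, pos]
  have hseg1 : ∀ a b, seg a b 1 = pos b := by intro a b; simp [seg, pos]
  -- Reversing segments brings any shared end to the start of both, where `hshare` applies.
  have hsegsymm : ∀ a b t, seg a b t = seg b a (unitInterval.symm t) := by
    intro a b t
    simp only [seg, unitInterval.coe_symm_eq]
    congr 2 <;> [ring; (congr 1; ring)]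
  have hposinj : Function.Injective pos := by
    intro a b hab
    rw [← hseg0 a a, ← hseg0 b b] at hab
    have := hseg_eq hab
    simp only [Set.Icc.coe_zero, zero_mul, add_zero] at this
    exact hqinj (Prod.ext this.1 this.2)
  -- two segments from a common end
  have hshare : ∀ a b d s t, a ≠ b → a ≠ d → b ≠ d → seg a b s = seg a d t →
      pos a = seg a b s := by
    intro a b d s t h1 h2 h3 h
    obtain ⟨hx, hy⟩ := hseg_eq h
    have : (s : ℝ) = 0 := segment_param_eq_zero (hgen' a b d h1 h2 h3) hx hy
    rw [show s = 0 from Subtype.ext this, hseg0]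
  have hcross : ∀ a b c d s t, H.Adj a b → H.Adj c d → s(a, b) ≠ s(c, d) →
      seg a b s = seg c d t → ∃ v, v ∈ s(a, b) ∧ v ∈ s(c, d) ∧ pos v = seg a b s := by
    intro a b c d s t hab hcd hne h
    by_cases hac : a = c
    · subst hac
      exact ⟨a, by simp, by simp,
        hshare a b d s t hab.ne hcd.ne (by rintro rfl; exact hne rfl) h⟩
    by_cases had : a = d
    · subst had
      rw [hsegsymm c a] at h
      exact ⟨a, by simp, by simp,
        hshare a b c s _ hab.ne hac (by rintro rfl; exact hne Sym2.eq_swap) h⟩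
    rw [hsegsymm a b] at h ⊢
    by_cases hbc : b = c
    · subst hbc
      exact ⟨b, by simp, by simp, hshare b a d _ t hab.ne.symm hcd.ne had h⟩
    by_cases hbd : b = d
    · subst hbd
      rw [hsegsymm c b] at h
      exact ⟨b, by simp, by simp, hshare b a c _ _ hab.ne.symm hbc hac h⟩
    rw [← hsegsymm a b] at h
    obtain ⟨hx, hy⟩ := hseg_eq h
    rcases hsep' a b c d hab hcd hac had hbc hbd with hs | hs
    · exact (segment_ne_of_orient_mul_pos hs t.2 hx hy).elim
    · exact (segment_ne_of_orient_mul_pos hs s.2 hx.symm hy.symm).elim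
  -- Each edge is drawn along an arbitrarily chosen orientation.
  have hout : ∀ e : H.edgeSet, s((Quot.out e.1).1, (Quot.out e.1).2) = e.1 :=
    fun e => Quot.out_eq e.1
  have hadj : ∀ e : H.edgeSet, H.Adj (Quot.out e.1).1 (Quot.out e.1).2 := by
    intro e
    rw [← SimpleGraph.mem_edgeSet, hout]
    exact e.2
  refine ⟨pos, fun e => seg (Quot.out e.1).1 (Quot.out e.1).2, hposinj, ?_, ?_, ?_, ?_⟩
  · intro e
    refine ⟨?_, ?_⟩
    · refine (PiLp.continuous_toLp 2 _).comp (continuous_pi fun i => ?_)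
      fin_cases i <;> simp <;> fun_prop
    · intro s t hst
      obtain ⟨hx, hy⟩ := hseg_eq hst
      by_contra hne
      have hne' : (s : ℝ) - t ≠ 0 := sub_ne_zero.2 fun h => hne (Subtype.ext h)
      refine (hadj e).ne (hqinj (Prod.ext ?_ ?_))
      · have := mul_left_cancel₀ hne' (a := (s : ℝ) - t) (b := (q (Quot.out e.1).2).1 -
          (q (Quot.out e.1).1).1) (c := 0) (by linear_combination hx)
        linarith
      · have := mul_left_cancel₀ hne' (a := (s : ℝ) - t) (b := (q (Quot.out e.1).2).2 -
          (q (Quot.out e.1).1).2) (c := 0) (by linear_combination hy)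
        linarith
  · intro e
    simp only [hseg0, hseg1]
    conv_lhs => rw [← hout e]
    rfl
  · rintro e v ⟨t, ht⟩
    rw [← hout e, Sym2.mem_iff]
    by_contra! hv
    refine hgen' _ _ v (hadj e).ne hv.1.symm hv.2.symm ?_
    rw [← hseg0 v v] at ht
    have := hseg_eq ht
    simp only [Set.Icc.coe_zero, zero_mul, add_zero] at this
    rw [show q v = (_, _) from Prod.ext this.1.symm this.2.symm]
    exact orient_segment _
  · rintro e f hef x ⟨⟨s, hs⟩, t, ht⟩
    have := hcross _ _ _ _ s t (hadj e) (hadj f)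
      (by rw [hout, hout]; exact fun h => hef (Subtype.ext h)) (hs.trans ht.symm)
    rw [hout, hout] at this
    obtain ⟨v, hve, hvf, hv⟩ := this
    exact ⟨v, hve, hvf, hv.trans hs⟩

/-- The criterion `isPlanar_of_points` for a graph given by a finite list of edges. -/
theorem isPlanar_of_list {n : ℕ} (H : SimpleGraph (Fin n)) (L : List (Fin n × Fin n))
    (hL : ∀ a b, H.Adj a b → (a, b) ∈ L ∨ (b, a) ∈ L) (p : Fin n → ℤ × ℤ)
    (hinj : ∀ a b, a ≠ b → p a ≠ p b)
    (hgen : ∀ a b c, a ≠ b → a ≠ c → b ≠ c → orient (p a) (p b) (p c) ≠ 0)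
    (hsep : ∀ e ∈ L, ∀ f ∈ L, e.1 ≠ f.1 → e.1 ≠ f.2 → e.2 ≠ f.1 → e.2 ≠ f.2 →
      0 < orient (p e.1) (p e.2) (p f.1) * orient (p e.1) (p e.2) (p f.2) ∨
      0 < orient (p f.1) (p f.2) (p e.1) * orient (p f.1) (p f.2) (p e.2)) : IsPlanar H := by
  -- Reversing an edge flips both factors of a product in `hsep`, so listing each edge in one
  -- orientation suffices.
  have hneg : ∀ a b c, orient (p b) (p a) c = - orient (p a) (p b) c := by
    intro a b c; simp only [orient]; ring
  refine isPlanar_of_points H p (fun a b h => by_contra fun hab => hinj a b hab h) hgen ?_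
  intro a b c d hab hcd h1 h2 h3 h4
  rcases hL _ _ hab with he | he <;> rcases hL _ _ hcd with hf | hf
  · exact hsep _ he _ hf h1 h2 h3 h4
  · have := hsep _ he _ hf h2 h1 h4 h3
    simp only [hneg c d, neg_mul_neg] at this
    rwa [mul_comm (orient (p a) (p b) (p d))] at this
  · have := hsep _ he _ hf h3 h4 h1 h2
    simp only [hneg a b, neg_mul_neg] at this
    rwa [mul_comm (orient (p c) (p d) (p b))] at this
  · have := hsep _ he _ hf h4 h3 h2 h1
    simp only [hneg a b, hneg c d, neg_mul_neg] at this
    rwa [mul_comm (orient (p a) (p b) (p d)), mul_comm (orient (p c) (p d) (p b))] at this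

/-! ### Drawings of the seven types -/

theorem isPlanar_sixType1 : IsPlanar sixType1 :=
  isPlanar_of_list _
    [(0, 1), (1, 2), (1, 3), (1, 4), (1, 5), (2, 3), (2, 5), (3, 5), (4, 5)]
    (by simp only [sixType1, SimpleGraph.fromEdgeSet_adj, Set.mem_insert_iff,
          Set.mem_singleton_iff]; decide)
    ![(3, 3), (1, 2), (2, 2), (4, 3), (1, 0), (3, 0)]
    (by decide +kernel) (by decide +kernel) (by decide +kernel)

theorem isPlanar_sixType2 : IsPlanar sixType2 :=
  isPlanar_of_list _
    [(0, 1), (0, 4), (1, 2), (1, 3), (1, 4), (1, 5), (2, 4), (2, 5), (3, 4), (3, 5), (4, 5)]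
    (by simp only [sixType2, SimpleGraph.fromEdgeSet_adj, Set.mem_insert_iff,
          Set.mem_singleton_iff]; decide +kernel)
    ![(2, 0), (0, 0), (2, 2), (1, 4), (4, 3), (1, 2)]
    (by decide +kernel) (by decide +kernel) (by decide +kernel)

theorem isPlanar_sixType3 : IsPlanar sixType3 :=
  isPlanar_of_list _
    [(0, 1), (0, 4), (1, 2), (1, 3), (1, 4), (1, 5), (2, 3), (2, 4), (2, 5), (3, 4), (3, 5)]
    (by simp only [sixType3, SimpleGraph.fromEdgeSet_adj, Set.mem_insert_iff,
          Set.mem_singleton_iff]; decide +kernel)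
    ![(0, 2), (2, 0), (1, 3), (4, 2), (0, 4), (2, 1)]
    (by decide +kernel) (by decide +kernel) (by decide +kernel)

theorem isPlanar_sixType4 : IsPlanar sixType4 :=
  isPlanar_of_list _
    [(0, 1), (0, 2), (0, 3), (0, 4), (0, 5), (1, 2), (1, 3), (1, 4), (1, 5), (2, 5), (3, 4),
      (3, 5)]
    (by simp only [sixType4, SimpleGraph.fromEdgeSet_adj, Set.mem_insert_iff,
          Set.mem_singleton_iff]; decide +kernel)
    ![(0, 3), (3, 1), (2, 2), (4, 4), (3, 0), (2, 3)]
    (by decide +kernel) (by decide +kernel) (by decide +kernel)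

theorem isPlanar_sevenType1 : IsPlanar sevenType1 :=
  isPlanar_of_list _
    [(0, 1), (0, 2), (0, 3), (0, 4), (0, 5), (0, 6), (1, 3), (1, 4), (1, 5), (1, 6), (3, 6),
      (4, 6)]
    (by simp only [sevenType1, SimpleGraph.fromEdgeSet_adj, Set.mem_insert_iff,
          Set.mem_singleton_iff]; decide +kernel)
    ![(0, 0), (4, 2), (1, 3), (2, 4), (1, 1), (3, 1), (2, 3)]
    (by decide +kernel) (by decide +kernel) (by decide +kernel)

theorem isPlanar_sevenType2 : IsPlanar sevenType2 :=
  isPlanar_of_list _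
    [(0, 1), (0, 2), (0, 4), (0, 5), (0, 6), (1, 2), (1, 5), (1, 6), (2, 3), (2, 4), (2, 5),
      (2, 6), (3, 5), (4, 5)]
    (by simp only [sevenType2, SimpleGraph.fromEdgeSet_adj, Set.mem_insert_iff,
          Set.mem_singleton_iff]; decide +kernel)
    ![(2, 3), (6, 4), (0, 7), (8, 4), (1, 3), (1, 2), (2, 5)]
    (by decide +kernel) (by decide +kernel) (by decide +kernel)

theorem isPlanar_sevenType3 : IsPlanar sevenType3 :=
  isPlanar_of_list _
    [(0, 1), (0, 2), (0, 4), (0, 5), (0, 6), (1, 2), (1, 3), (1, 5), (1, 6), (2, 3), (2, 4),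
      (2, 5), (2, 6), (3, 6), (4, 6)]
    (by simp only [sevenType3, SimpleGraph.fromEdgeSet_adj, Set.mem_insert_iff,
          Set.mem_singleton_iff]; decide +kernel)
    ![(9, 4), (4, 4), (12, 1), (0, 2), (10, 5), (7, 3), (9, 11)]
    (by decide +kernel) (by decide +kernel) (by decide +kernel)

/-! ### Graphs with at most five vertices -/

/-- The complete graph on five vertices without the edge `34`. -/
def fiveMinusEdge : SimpleGraph (Fin 5) :=
  SimpleGraph.fromEdgeSet {s(3, 4)}ᶜ

theorem fiveMinusEdge_adj {a b : Fin 5} :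
    fiveMinusEdge.Adj a b ↔ s(a, b) ≠ s(3, 4) ∧ a ≠ b := by
  simp [fiveMinusEdge]

theorem isPlanar_fiveMinusEdge : IsPlanar fiveMinusEdge :=
  isPlanar_of_list _
    [(0, 1), (0, 2), (0, 3), (0, 4), (1, 2), (1, 3), (1, 4), (2, 3), (2, 4)]
    (by simp only [fiveMinusEdge_adj]; decide +kernel)
    ![(2, 1), (4, 4), (4, 0), (0, 0), (3, 2)]
    (by decide +kernel) (by decide +kernel) (by decide +kernel)

/-- A graph on at most four vertices is planar. -/
theorem isPlanar_of_card_le_four {V : Type*} [Fintype V] (G : SimpleGraph V)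
    (h : Fintype.card V ≤ 4) : IsPlanar G := by
  obtain ⟨g⟩ : Nonempty (V ↪ Fin 4) :=
    Function.Embedding.nonempty_of_card_le (by simpa using h)
  have hne : ∀ x : Fin 4, x.castSucc ≠ 4 := by decide
  refine isPlanar_fiveMinusEdge.of_injective_hom
    ⟨fun v => (g v).castSucc, fun {a b} hab => ?_⟩
    ((Fin.castSucc_injective 4).comp g.injective)
  rw [fiveMinusEdge_adj]
  refine ⟨fun h => ?_, fun h => hab.ne (g.injective (Fin.castSucc_injective 4 h))⟩
  rcases Sym2.eq_iff.1 h with h | h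
  · exact hne _ h.2
  · exact hne _ h.1

/-- A graph on five vertices that is not complete is planar. -/
theorem isPlanar_of_card_eq_five {V : Type*} [Fintype V] (G : SimpleGraph V)
    (h : Fintype.card V = 5) {u v : V} (huv : u ≠ v) (hadj : ¬ G.Adj u v) : IsPlanar G := by
  classical
  let e : V ≃ Fin 5 := Fintype.equivFinOfCardEq h
  -- `σ` sends `u` to 3; `τ` then sends `v` to 4 and fixes 3, so the non-edge `uv` lands on the
  -- missing edge.
  let σ : Equiv.Perm (Fin 5) := Equiv.swap (e u) 3
  let τ : Equiv.Perm (Fin 5) := Equiv.swap (σ (e v)) 4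
  let g : V ≃ Fin 5 := (e.trans σ).trans τ
  have hσu : σ (e u) = 3 := Equiv.swap_apply_left _ _
  have hσv : (3 : Fin 5) ≠ σ (e v) := by
    rw [← hσu]
    exact fun h => huv (e.injective (σ.injective h))
  have hgu : g u = 3 := by
    simp only [g, Equiv.trans_apply, hσu]
    exact Equiv.swap_apply_of_ne_of_ne hσv (by decide)
  have hgv : g v = 4 := Equiv.swap_apply_left _ _
  refine isPlanar_fiveMinusEdge.of_injective_hom ⟨g, fun {a b} hab => ?_⟩ g.injective
  rw [fiveMinusEdge_adj, ← hgu, ← hgv]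
  refine ⟨fun h => ?_, fun h => hab.ne (g.injective h)⟩
  rcases Sym2.eq_iff.1 h with h | h
  · rw [g.injective h.1, g.injective h.2] at hab
    exact hadj hab
  · rw [g.injective h.1, g.injective h.2] at hab
    exact hadj hab.symm

/-! ### Irreducible ideals -/

/-- If `I` is an irreducible ideal, at most one element outside `I` becomes an ideal together
with `I`. -/
theorem IsIrreducibleIdeal.eq_of_isIdeal_insert {Λ : AddSubmonoid ℕ} {I : Set ℕ}
    (hI : IsIrreducibleIdeal Λ I) {y z : Vertex Λ I}
    (hy : IsIdeal Λ (insert (y : ℕ) I)) (hz : IsIdeal Λ (insert (z : ℕ) I)) : y = z := by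
  by_contra hne
  -- An ideal containing 0 is all of `Λ`; adjoining a nonzero element therefore leaves `I` proper.
  have h0 : (0 : ℕ) ∉ I := fun h => y.2.1.2 (by simpa using hI.1.2 0 h y y.2.1.1)
  have hproper : ∀ x : Vertex Λ I, insert (x : ℕ) I ≠ (Λ : Set ℕ) := by
    intro x h
    have : (0 : ℕ) ∈ insert (x : ℕ) I := by rw [h]; exact Λ.zero_mem
    rcases this with h | h
    · exact x.2.2 h.symm
    · exact h0 h
  refine hI.2 ⟨_, _, hy, hz, hproper y, hproper z, Set.ssubset_insert y.2.1.2,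
    Set.ssubset_insert z.2.1.2, ?_⟩
  ext x
  simp only [Set.mem_inter_iff, Set.mem_insert_iff]
  refine ⟨fun h => ⟨.inr h, .inr h⟩, ?_⟩
  rintro ⟨rfl | h, h' | h'⟩
  · exact (hne (Subtype.ext h')).elim
  all_goals assumption

/-- An element of `Λ` is 0, in `I`, or a vertex, so only sums with vertices need checking. The case
`z = y` is included, though adjacency says nothing about it. -/
theorem IsIdeal.insert_vertex {Λ : AddSubmonoid ℕ} {I : Set ℕ} (hI : IsIdeal Λ I)
    (y : Vertex Λ I) (h : ∀ z : Vertex Λ I, (y : ℕ) + z ∈ I) :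
    IsIdeal Λ (insert (y : ℕ) I) := by
  refine ⟨Set.insert_subset y.2.1.1 hI.1, ?_⟩
  rintro i (rfl | hi) s hs
  · by_cases hs0 : s = 0
    · simp [hs0]
    right
    by_cases hsI : s ∈ I
    · rw [add_comm]
      exact hI.2 s hsI _ y.2.1.1
    · exact h ⟨s, ⟨hs, hsI⟩, hs0⟩
  · exact .inr (hI.2 i hi s hs)

/-- The graph of an irreducible ideal with at least three vertices is not complete. -/
theorem exists_not_adj_of_isIrreducibleIdeal {Λ : AddSubmonoid ℕ} {I : Set ℕ}
    (hI : IsIrreducibleIdeal Λ I) [Fintype (Vertex Λ I)]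
    (hcard : 3 ≤ Fintype.card (Vertex Λ I)) :
    ∃ u v : Vertex Λ I, u ≠ v ∧ ¬ (idealGraph Λ I).Adj u v := by
  classical
  by_contra! hcon
  have hadd : ∀ u v : Vertex Λ I, u ≠ v → (u : ℕ) + v ∈ I := fun u v h => (hcon u v h).2
  have hne : (Finset.univ : Finset (Vertex Λ I)).Nonempty := by
    rw [← Finset.card_pos, Finset.card_univ]; omega
  obtain ⟨m, -, hm⟩ := Finset.exists_max_image Finset.univ (fun v : Vertex Λ I => (v : ℕ)) hne
  -- Otherwise `m + z` would be a vertex larger than `m`.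
  have hmI : ∀ z : Vertex Λ I, (m : ℕ) + z ∈ I := by
    intro z
    by_contra h
    have := hm ⟨m + z, ⟨Λ.add_mem m.2.1.1 z.2.1.1, h⟩, by have := m.2.2; omega⟩
      (Finset.mem_univ _)
    have := z.2.2
    simp only at *
    omega
  -- If `2y ∈ I`, then `y` absorbs every vertex, so `y = m`. Otherwise `w = 2y` is a vertex adjacent
  -- to `y`, hence `2w = (w + y) + y ∈ I` and `w` is the absorbing vertex.
  have hdouble : ∀ y : Vertex Λ I, y ≠ m → (y : ℕ) + y = m := by
    intro y hym
    have hyy : (y : ℕ) + y ∉ I := by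
      intro h
      refine hym (hI.eq_of_isIdeal_insert (hI.1.insert_vertex y fun z => ?_)
        (hI.1.insert_vertex m hmI))
      by_cases hz : y = z
      · rwa [← hz]
      · exact hadd y z hz
    have hy0 := y.2.2
    let w : Vertex Λ I := ⟨y + y, ⟨Λ.add_mem y.2.1.1 y.2.1.1, hyy⟩, by omega⟩
    have hwy : w ≠ y := fun h => by
      have : (y : ℕ) + y = y := congrArg Subtype.val h
      omega
    have hww : (w : ℕ) + w ∈ I := by
      have := hI.1.2 _ (hadd w y hwy) y y.2.1.1
      rwa [add_assoc] at this
    have hwm : w = m := by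
      refine hI.eq_of_isIdeal_insert (hI.1.insert_vertex w fun z => ?_)
        (hI.1.insert_vertex m hmI)
      by_cases hz : w = z
      · rwa [← hz]
      · exact hadd w z hz
    exact congrArg Subtype.val hwm
  have : 1 < (Finset.univ.erase m).card := by
    rw [Finset.card_erase_of_mem (Finset.mem_univ _), Finset.card_univ]; omega
  obtain ⟨a, ha, b, hb, hab⟩ := Finset.one_lt_card.1 this
  have h1 := hdouble a (Finset.ne_of_mem_erase ha)
  have h2 := hdouble b (Finset.ne_of_mem_erase hb)
  exact hab (Subtype.ext (by omega))

theorem IsPlanar.of_isOfType {V W : Type*} {G : SimpleGraph V} {H : SimpleGraph W}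
    (hH : IsPlanar H) (h : IsOfType G H) : IsPlanar G :=
  h.elim fun e => hH.of_injective_hom e.toHom e.injective

end NumSemigroup

theorem mainTheorem1 (Λ : AddSubmonoid ℕ) (hΛ : NumSemigroup.IsNumericalSemigroup Λ)
    (hdim : 2 ≤ NumSemigroup.embeddingDimension Λ)
    (I : Set ℕ) (hI : NumSemigroup.IsIrreducibleIdeal Λ I)
    (h : ENat.card (NumSemigroup.Vertex Λ I) ≤ 5 ∨
      (ENat.card (NumSemigroup.Vertex Λ I) = 6 ∧
        (NumSemigroup.IsOfType (NumSemigroup.idealGraph Λ I) NumSemigroup.sixType1 ∨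
         NumSemigroup.IsOfType (NumSemigroup.idealGraph Λ I) NumSemigroup.sixType2 ∨
         NumSemigroup.IsOfType (NumSemigroup.idealGraph Λ I) NumSemigroup.sixType3 ∨
         NumSemigroup.IsOfType (NumSemigroup.idealGraph Λ I) NumSemigroup.sixType4)) ∨
      (ENat.card (NumSemigroup.Vertex Λ I) = 7 ∧
        (NumSemigroup.IsOfType (NumSemigroup.idealGraph Λ I) NumSemigroup.sevenType1 ∨
         NumSemigroup.IsOfType (NumSemigroup.idealGraph Λ I) NumSemigroup.sevenType2 ∨
         NumSemigroup.IsOfType (NumSemigroup.idealGraph Λ I) NumSemigroup.sevenType3))) :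
    NumSemigroup.IsPlanar (NumSemigroup.idealGraph Λ I) := by
  open NumSemigroup in
  rcases h with h | ⟨-, h | h | h | h⟩ | ⟨-, h | h | h⟩
  · have hlt : ENat.card (Vertex Λ I) < ⊤ := lt_of_le_of_lt h (by exact ENat.natCast_lt_top 5)
    have : Finite (Vertex Λ I) := ENat.card_lt_top.1 hlt
    have := Fintype.ofFinite (Vertex Λ I)
    rw [ENat.card_eq_coe_fintype_card] at h
    have hcard : Fintype.card (Vertex Λ I) ≤ 5 := by exact_mod_cast h
    rcases hcard.lt_or_eq with h4 | h5
    · exact isPlanar_of_card_le_four _ (by omega)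
    · obtain ⟨u, v, huv, hadj⟩ := exists_not_adj_of_isIrreducibleIdeal hI (by omega)
      exact isPlanar_of_card_eq_five _ h5 huv hadj
  · exact isPlanar_sixType1.of_isOfType h
  · exact isPlanar_sixType2.of_isOfType h
  · exact isPlanar_sixType3.of_isOfType h
  · exact isPlanar_sixType4.of_isOfType h
  · exact isPlanar_sevenType1.of_isOfType h
  · exact isPlanar_sevenType2.of_isOfType h
  · exact isPlanar_sevenType3.of_isOfType h
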